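/- Let $S$ be a monoid. A right $S$-act is a set $A$ with a right action of $S$ (so $a1=a$ and $(as)t=a(st)$), and an $S$-map is a map $f$ with $f(as)=f(a)s$. An act $A$ is cyclic if $A=aS$ for some $a\in A$; locally cyclic if it is non-empty and for all $x,y\in A$ there are $z\in A$, $s,t\in S$ with $x=zs$, $y=zt$; and indecomposable if it is non-empty and not the disjoint union of two non-empty subacts. $A$ satisfies condition $(P)$ if whenever $au=a'u'$ with $a,a'\in A$, $u,u'\in S$, there are $a''\in A$, $s,s'\in S$ with $a=a''s$, $a'=a''s'$, $su=s'u'$; it satisfies condition $(E)$ if whenever $au=au'$ with $a\in A$, $u,u'\in S$, there are $a''\in A$, $s\in S$ with $a=a''s$, $su=su'$. $A$ is strongly flat if it satisfies $(P)$ and $(E)$. Let $\mathcal{SF}$ be the class of strongly flat acts and $\mathcal{CP}$ the class of acts satisfying $(P)$. For a class $\mathcal X$ of right $S$-acts, an $\mathcal X$-cover of $A$ is an $S$-map $g:P\to A$ with $P\in\mathcal X$ such that (i) for every $S$-map $g':P'\to A$ with $P'\in\mathcal X$ there is an $S$-map $f:P'\to P$ with $gf=g'$, and (ii) every $S$-map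 $f:P\to P$ with $gf=g$ is an isomorphism. The monoid $S$ satisfies condition $(A)$ if every right $S$-act satisfies the ascending chain condition for cyclic subacts. 1. $S$ satisfies condition $(A)$ if and only if every locally cyclic right $S$-act is cyclic. 2. If $S$ satisfies condition $(A)$, then every right $S$-act has an $\mathcal{SF}$-cover and a $\mathcal{CP}$-cover. 3. If $S$ satisfies condition $(A)$, then every indecomposable right $S$-act $A$ satisfying $(P)$ (in particular every indecomposable strongly flat act) is cyclic and has $|A|\le|S|$. 4. The following monoids satisfy condition $(A)$, so every right act over them has an $\mathcal{SF}$-cover and a $\mathcal{CP}$-cover: finite monoids; rectangular bands with a $1$ adjoined; right groups (right simple left cancellative semigroups) with a $1$ adjoined; right simple semigroups (semigroups $R$ with $aR=R$ for all $a\in R$) with a $1$ adjoined; and $(\mathbb N,\max)$. -/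

import Mathlib

open scoped RightActions

universe u v

/-! A right `S`-act is a type `A` with `[MulAction Sᵐᵒᵖ A]`; the action `a s` is written `a <• s`
(it is `MulOpposite.op s • a`), and the `S`-maps from `A` to `B` are the elements of
`A →[Sᵐᵒᵖ] B`. -/

namespace RightAct

section Acts

variable (S : Type u) [Monoid S]

/-- Condition (P): if `a u = a' u'` then `a = a'' s`, `a' = a'' s'` and `s u = s' u'`
for some `a''`, `s`, `s'`. -/
def ConditionP (A : Type v) [MulAction Sᵐᵒᵖ A] : Prop :=
  ∀ (a a' : A) (u u' : S), a <• u = a' <• u' →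
    ∃ (a'' : A) (s s' : S), a = a'' <• s ∧ a' = a'' <• s' ∧ s * u = s' * u'

/-- Condition (E): if `a u = a u'` then `a = a'' s` and `s u = s u'` for some `a''`, `s`. -/
def ConditionE (A : Type v) [MulAction Sᵐᵒᵖ A] : Prop :=
  ∀ (a : A) (u u' : S), a <• u = a <• u' →
    ∃ (a'' : A) (s : S), a = a'' <• s ∧ s * u = s * u'

/-- Strongly flat acts: those with (P) and (E). -/
def StronglyFlat (A : Type v) [MulAction Sᵐᵒᵖ A] : Prop :=
  ConditionP S A ∧ ConditionE S A

/-- The cyclic subact `a S`, as a set. -/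
def cyclicSubact {A : Type v} [MulAction Sᵐᵒᵖ A] (a : A) : Set A :=
  {b | ∃ s : S, b = a <• s}

/-- An act is cyclic if it equals `a S` for some `a`. -/
def IsCyclic (A : Type v) [MulAction Sᵐᵒᵖ A] : Prop :=
  ∃ a : A, cyclicSubact S a = Set.univ

/-- A (non-empty) act is locally cyclic if any two elements lie in a common cyclic subact. -/
def IsLocallyCyclic (A : Type v) [MulAction Sᵐᵒᵖ A] : Prop :=
  Nonempty A ∧ ∀ x y : A, ∃ (z : A) (s t : S), x = z <• s ∧ y = z <• t

/-- An act is indecomposable if it is non-empty and is not the disjoint union of two non-empty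
subacts. -/
def IsIndecomposable (A : Type v) [MulAction Sᵐᵒᵖ A] : Prop :=
  Nonempty A ∧ ¬ ∃ B C : SubMulAction Sᵐᵒᵖ A,
    (B : Set A).Nonempty ∧ (C : Set A).Nonempty ∧
      Disjoint (B : Set A) (C : Set A) ∧ (B : Set A) ∪ (C : Set A) = Set.univ

/-- Condition (A): every right `S`-act satisfies the ascending chain condition for cyclic
subacts. -/
def ConditionA : Prop :=
  ∀ (A : Type v) [MulAction Sᵐᵒᵖ A] (a : ℕ → A),
    (∀ n, cyclicSubact S (a n) ⊆ cyclicSubact S (a (n + 1))) →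
      ∃ N, ∀ n, N ≤ n → cyclicSubact S (a n) = cyclicSubact S (a N)

variable {S}

/-- `g : P → A` is an `𝒳`-precover: `P` is in `𝒳` and every `S`-map `P' → A` with `P'` in `𝒳`
factors through `g`. -/
def IsPrecover (𝒳 : ∀ (P : Type v) [MulAction Sᵐᵒᵖ P], Prop) {P A : Type v}
    [MulAction Sᵐᵒᵖ P] [MulAction Sᵐᵒᵖ A] (g : P →[Sᵐᵒᵖ] A) : Prop :=
  𝒳 P ∧ ∀ (P' : Type v) [MulAction Sᵐᵒᵖ P'], 𝒳 P' →
    ∀ g' : P' →[Sᵐᵒᵖ] A, ∃ f : P' →[Sᵐᵒᵖ] P, g.comp f = g'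

/-- An `𝒳`-cover is an `𝒳`-precover `g : P → A` such that every `S`-map `f : P → P` with
`g f = g` is an isomorphism (that is, a bijective `S`-map). -/
def IsCover (𝒳 : ∀ (P : Type v) [MulAction Sᵐᵒᵖ P], Prop) {P A : Type v}
    [MulAction Sᵐᵒᵖ P] [MulAction Sᵐᵒᵖ A] (g : P →[Sᵐᵒᵖ] A) : Prop :=
  IsPrecover 𝒳 g ∧ ∀ f : P →[Sᵐᵒᵖ] P, g.comp f = g → Function.Bijective f

/-- The act `A` has an `𝒳`-cover. -/
def HasCover (𝒳 : ∀ (P : Type v) [MulAction Sᵐᵒᵖ P], Prop) (A : Type v)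
    [MulAction Sᵐᵒᵖ A] : Prop :=
  ∃ (P : Type v) (_ : MulAction Sᵐᵒᵖ P) (g : P →[Sᵐᵒᵖ] A), IsCover 𝒳 g

variable (S)

/-- Every right `S`-act has an SF-cover and a CP-cover, where SF is the class of strongly flat
acts and CP the class of acts with condition (P). -/
def EveryActHasSFAndCPCover : Prop :=
  ∀ (A : Type v) [MulAction Sᵐᵒᵖ A],
    HasCover (S := S) (fun P _ => StronglyFlat S P) A ∧
      HasCover (S := S) (fun P _ => ConditionP S P) A

end Acts

section Examples

/-- A rectangular band: a semigroup with `a b a = a` for all `a`, `b`. -/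
def IsRectangularBand (R : Type u) [Semigroup R] : Prop :=
  ∀ a b : R, a * b * a = a

/-- A right simple semigroup: `a R = R` for every `a`. -/
def IsRightSimple (R : Type u) [Semigroup R] : Prop :=
  ∀ a b : R, ∃ x : R, a * x = b

/-- A right group: a right simple and left cancellative semigroup. -/
def IsRightGroup (R : Type u) [Semigroup R] : Prop :=
  IsRightSimple R ∧ ∀ a b c : R, a * b = a * c → b = c

/-- The natural numbers, to be given the operation `max`. -/
def MaxNat : Type := ℕ

/-- The monoid `(ℕ, max)`, with identity `0`. -/
instance : Monoid MaxNat where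
  mul a b := Nat.max a b
  one := Nat.zero
  mul_assoc a b c := Nat.max_assoc a b c
  one_mul a := Nat.zero_max a
  mul_one a := Nat.max_zero a

end Examples

end RightAct

/-! Condition (A) says that passing to strictly larger cyclic subacts is well founded, so every
element lies below a generator of a maximal cyclic subact. Condition (P) makes the order "lies in
the cyclic subact of" confluent (`ConditionP.below_common`). Hence over (A) an act with (P) splits
into cyclic components, each a quotient of `S` by a kernel that is again flat (`Flat.ker`). `Flat`
carries (P) with or without (E), so both kinds of cover come from one argument.

The cover of `A` is the coproduct of the terminal cyclic flat acts over `A`, one per isomorphism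
class. Terminal objects exist because Zorn enlarges any congruence to a maximal one, and a sequence
of maps between maximal objects must contain an isomorphism (`exists_isIso`): its colimit is flat,
(A) makes it cyclic, and maximality identifies late terms with it. Every flat act over `A` then maps
componentwise into the coproduct, while an endomorphism over `A` must fix each component and be
bijective there (`coverMap_endo`). -/

namespace RightAct

/-! ### The preorder of cyclic subacts, condition (A) and local cyclicity. -/

section Preorder

variable {S : Type u} [Monoid S] {A : Type v} [MulAction Sᵐᵒᵖ A]

theorem act_act (a : A) (s t : S) : (a <• s) <• t = a <• (s * t) := by
  simp [mul_smul]

theorem act_one (a : A) : a <• (1 : S) = a := by simp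

variable (S) in
/-- `x` lies in the cyclic subact generated by `z`. -/
def Below (x z : A) : Prop := ∃ s : S, x = z <• s

theorem Below.refl (x : A) : Below S x x := ⟨1, (act_one x).symm⟩

theorem Below.trans {x y z : A} : Below S x y → Below S y z → Below S x z := by
  rintro ⟨s, rfl⟩ ⟨t, rfl⟩
  exact ⟨t * s, act_act z t s⟩

theorem below_act (x : A) (s : S) : Below S (x <• s) x := ⟨s, rfl⟩

theorem cyclicSubact_subset_iff {x z : A} :
    cyclicSubact S x ⊆ cyclicSubact S z ↔ Below S x z :=
  ⟨fun h => h (Below.refl x), fun h _ hy => Below.trans hy h⟩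

variable (S A) in
/-- `c` generates a strictly larger cyclic subact than `z`. -/
def StrictlyAbove (c z : A) : Prop := Below S z c ∧ ¬ Below S c z

theorem below_of_le {a : ℕ → A} (h : ∀ n, Below S (a n) (a (n + 1))) {m n : ℕ} (hmn : m ≤ n) :
    Below S (a m) (a n) := by
  induction n, hmn using Nat.le_induction with
  | base => exact Below.refl _
  | succ n _ ih => exact ih.trans (h n)

variable (S) in
theorem conditionA_iff_wellFounded :
    ConditionA.{u, v} S ↔
      ∀ (A : Type v) [MulAction Sᵐᵒᵖ A], WellFounded (StrictlyAbove S A) := by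
  constructor
  · intro h A _
    rw [wellFounded_iff_isEmpty_descending_chain]
    refine ⟨fun ⟨a, ha⟩ => ?_⟩
    obtain ⟨N, hN⟩ := h A a fun n => cyclicSubact_subset_iff.2 (ha n).1
    exact (ha N).2 (cyclicSubact_subset_iff.1 (hN (N + 1) N.le_succ).subset)
  · intro h A _ a ha
    obtain ⟨_, ⟨N, rfl⟩, hN⟩ := (h A).has_min (Set.range a) (Set.range_nonempty a)
    refine ⟨N, fun n hn => ?_⟩
    have hb := below_of_le (fun n => cyclicSubact_subset_iff.1 (ha n)) hn
    have hb' : Below S (a n) (a N) := by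
      by_contra hc
      exact hN _ ⟨n, rfl⟩ ⟨hb, hc⟩
    exact (cyclicSubact_subset_iff.2 hb').antisymm (cyclicSubact_subset_iff.2 hb)

variable (S) in
theorem conditionA_of_no_strict_chain
    (h : ∀ (A : Type v) [MulAction Sᵐᵒᵖ A] (a : ℕ → A) (s : ℕ → S),
      (∀ n, a n = a (n + 1) <• s n) → ∃ n, Below S (a (n + 1)) (a n)) :
    ConditionA.{u, v} S := by
  rw [conditionA_iff_wellFounded]
  intro A _
  rw [wellFounded_iff_isEmpty_descending_chain]
  refine ⟨fun ⟨a, ha⟩ => ?_⟩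
  choose s hs using fun n => (ha n).1
  obtain ⟨n, hn⟩ := h A a s hs
  exact (ha n).2 hn

variable (S) in
-- Needed because quotients of `S` and their sequential colimits live in the universe of `S`, not in
-- that of `A`.
theorem ConditionA.down (h : ConditionA.{u, max u v} S) : ConditionA.{u, u} S := by
  refine conditionA_of_no_strict_chain S fun A _ a s has => ?_
  obtain ⟨N, hN⟩ := h (ULift.{v} A) (fun n => ⟨a n⟩) fun n =>
    cyclicSubact_subset_iff.2 ⟨s n, congrArg ULift.up (has n)⟩
  obtain ⟨t, ht⟩ := cyclicSubact_subset_iff.1 (hN (N + 1) N.le_succ).subset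
  exact ⟨N, t, congrArg ULift.down ht⟩

/-- `z` generates a maximal cyclic subact. -/
def IsMaximalGenerator (S : Type u) [Monoid S] {A : Type v} [MulAction Sᵐᵒᵖ A] (z : A) : Prop :=
  ∀ c : A, Below S z c → Below S c z

theorem ConditionA.exists_maximalGenerator (h : ConditionA.{u, v} S) (p : A) :
    ∃ z : A, Below S p z ∧ IsMaximalGenerator S z := by
  obtain ⟨z, hz, hm⟩ := ((conditionA_iff_wellFounded S).1 h A).has_min
    {z | Below S p z} ⟨p, Below.refl p⟩
  exact ⟨z, hz, fun c hc => by_contra fun hn => hm c (hz.trans hc) ⟨hc, hn⟩⟩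

theorem isCyclic_iff : IsCyclic S A ↔ ∃ a : A, ∀ x : A, Below S x a := by
  simp only [IsCyclic, Set.eq_univ_iff_forall]
  rfl

theorem IsLocallyCyclic.isCyclic (h : ConditionA.{u, v} S) (hA : IsLocallyCyclic S A) :
    IsCyclic S A := by
  obtain ⟨⟨p⟩, hA⟩ := hA
  obtain ⟨z, -, hz⟩ := h.exists_maximalGenerator p
  refine isCyclic_iff.2 ⟨z, fun x => ?_⟩
  obtain ⟨w, s, t, hzw, hxw⟩ := hA z x
  exact Below.trans ⟨t, hxw⟩ (hz w ⟨s, hzw⟩)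

variable (S) in
-- The union of an ascending chain of cyclic subacts is locally cyclic; a generator of it already
-- lies in some term, where the chain stops.
theorem conditionA_of_isLocallyCyclic
    (h : ∀ (A : Type v) [MulAction Sᵐᵒᵖ A], IsLocallyCyclic S A → IsCyclic S A) :
    ConditionA.{u, v} S := by
  refine conditionA_of_no_strict_chain S fun A _ a s has => ?_
  have hab : ∀ n, Below S (a n) (a (n + 1)) := fun n => ⟨s n, has n⟩
  let B : SubMulAction Sᵐᵒᵖ A :=
    { carrier := {x | ∃ n, Below S x (a n)}
      smul_mem' := fun t _ ⟨n, hn⟩ => ⟨n, Below.trans (below_act _ t.unop) hn⟩ }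
  have hB : IsLocallyCyclic S B := by
    refine ⟨⟨⟨a 0, 0, Below.refl _⟩⟩, ?_⟩
    rintro ⟨x, m, hx⟩ ⟨y, n, hy⟩
    obtain ⟨p, hp⟩ := hx.trans (below_of_le hab (le_max_left m n))
    obtain ⟨q, hq⟩ := hy.trans (below_of_le hab (le_max_right m n))
    exact ⟨⟨a (max m n), _, Below.refl _⟩, p, q, Subtype.ext hp, Subtype.ext hq⟩
  obtain ⟨⟨z, N, hz⟩, hzB⟩ := isCyclic_iff.1 (h B hB)
  obtain ⟨t, ht⟩ := hzB ⟨a (N + 1), N + 1, Below.refl _⟩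
  exact ⟨N, Below.trans ⟨t, congrArg Subtype.val ht⟩ hz⟩

theorem ConditionP.below_common (hP : ConditionP S A) {x z w : A} (hz : Below S x z)
    (hw : Below S x w) : ∃ d, Below S z d ∧ Below S w d := by
  obtain ⟨s, hs⟩ := hz
  obtain ⟨t, ht⟩ := hw
  obtain ⟨d, p, q, hp, hq, -⟩ := hP z w s t (hs.symm.trans ht)
  exact ⟨d, ⟨p, hp⟩, ⟨q, hq⟩⟩

/-- By confluence, the elements sharing an upper bound with `x` form a subact whose complement is
also a subact. -/
theorem ConditionP.isLocallyCyclic (hP : ConditionP S A) (hA : IsIndecomposable S A) :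
    IsLocallyCyclic S A := by
  obtain ⟨hne, hA⟩ := hA
  refine ⟨hne, fun x y => ?_⟩
  suffices hxy : ∃ z, Below S x z ∧ Below S y z by
    obtain ⟨z, ⟨s, hs⟩, ⟨t, ht⟩⟩ := hxy
    exact ⟨z, s, t, hs, ht⟩
  by_contra hxy
  have hact : ∀ (y : A) (s : S), (∃ z, Below S x z ∧ Below S (y <• s) z) ↔
      ∃ z, Below S x z ∧ Below S y z := by
    refine fun y s => ⟨fun ⟨z, hx, hy⟩ => ?_, fun ⟨z, hx, hy⟩ => ⟨z, hx, (below_act y s).trans hy⟩⟩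
    obtain ⟨d, hd, hd'⟩ := hP.below_common hy (below_act y s)
    exact ⟨d, hx.trans hd, hd'⟩
  refine hA ⟨⟨{y | ∃ z, Below S x z ∧ Below S y z}, fun s y hy => (hact y s.unop).2 hy⟩,
    ⟨{y | ¬ ∃ z, Below S x z ∧ Below S y z}, fun s y hy h => hy ((hact y s.unop).1 h)⟩,
    ⟨x, x, Below.refl x, Below.refl x⟩, ⟨y, hxy⟩, ?_, ?_⟩
  · exact Set.disjoint_left.2 fun y hy hy' => hy' hy
  · exact Set.eq_univ_of_forall fun y => Classical.em _

theorem IsCyclic.mk_le {S : Type u} [Monoid S] {A : Type (max u v)} [MulAction Sᵐᵒᵖ A]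
    (h : IsCyclic S A) : Cardinal.mk A ≤ Cardinal.lift.{v} (Cardinal.mk S) := by
  obtain ⟨a, ha⟩ := isCyclic_iff.1 h
  rw [← Cardinal.mk_uLift]
  refine Cardinal.mk_le_of_surjective (f := fun s : ULift.{v} S => a <• s.down) fun x => ?_
  obtain ⟨s, hs⟩ := ha x
  exact ⟨⟨s⟩, hs.symm⟩

end Preorder

/-! ### Flat acts and their coproducts. -/

section Flat

variable {S : Type u} [Monoid S]

variable (S) in
/-- Condition (P), together with condition (E) when `e` holds. -/
def Flat (e : Prop) (A : Type v) [MulAction Sᵐᵒᵖ A] : Prop :=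
  ConditionP S A ∧ (e → ConditionE S A)

theorem Flat.sigma {e : Prop} {I : Type*} {X : I → Type v} [∀ i, MulAction Sᵐᵒᵖ (X i)]
    (h : ∀ i, Flat S e (X i)) : Flat S e (Σ i, X i) := by
  refine ⟨?_, fun he => ?_⟩
  · rintro ⟨i, x⟩ ⟨j, y⟩ u u' huu
    simp only [Sigma.smul_mk, Sigma.mk.injEq] at huu
    obtain ⟨rfl, huu⟩ := huu
    obtain ⟨c, s, s', rfl, rfl, hs⟩ := (h i).1 x y u u' (eq_of_heq huu)
    exact ⟨⟨i, c⟩, s, s', rfl, rfl, hs⟩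
  · rintro ⟨i, x⟩ u u' huu
    simp only [Sigma.smul_mk, Sigma.mk.injEq, true_and] at huu
    obtain ⟨c, s, rfl, hs⟩ := (h i).2 he x u u' (eq_of_heq huu)
    exact ⟨⟨i, c⟩, s, rfl, hs⟩

end Flat

/-! ### Congruences, kernels and sequential colimits. -/

section Congruence

variable (S : Type u) [Monoid S]

/-- A congruence on a right act. -/
structure ActCon (B : Type v) [MulAction Sᵐᵒᵖ B] extends Setoid B where
  act' : ∀ {x y : B} (s : S), toSetoid x y → toSetoid (x <• s) (y <• s)

variable {S} {B : Type v} [MulAction Sᵐᵒᵖ B]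

namespace ActCon

/-- The quotient of an act by a congruence. -/
def Quot (c : ActCon S B) : Type v := Quotient c.toSetoid

/-- The class of an element. -/
def cls (c : ActCon S B) (x : B) : c.Quot := Quotient.mk c.toSetoid x

theorem cls_eq {c : ActCon S B} {x y : B} : c.cls x = c.cls y ↔ c.toSetoid x y :=
  Quotient.eq

theorem cls_surjective (c : ActCon S B) (q : c.Quot) : ∃ x, c.cls x = q :=
  Quotient.exists_rep q

instance (c : ActCon S B) : MulAction Sᵐᵒᵖ c.Quot where
  smul s := Quotient.map (s • ·) fun _ _ h => c.act' s.unop h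
  one_smul q := by
    obtain ⟨x, rfl⟩ := c.cls_surjective q
    exact congrArg c.cls (one_smul _ x)
  mul_smul s t q := by
    obtain ⟨x, rfl⟩ := c.cls_surjective q
    exact congrArg c.cls (mul_smul s t x)

/-- An `S`-map on the quotient from a compatible `S`-map. -/
def lift {C : Type*} [MulAction Sᵐᵒᵖ C] (c : ActCon S B) (f : B →[Sᵐᵒᵖ] C)
    (h : ∀ x y, c.toSetoid x y → f x = f y) : c.Quot →[Sᵐᵒᵖ] C where
  toFun := Quotient.lift f h
  map_smul' s q := by
    obtain ⟨x, rfl⟩ := c.cls_surjective q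
    exact map_smul f s x

/-- The kernel of `s ↦ z s`, a congruence on `S`. -/
def ker (S : Type u) [Monoid S] {B : Type v} [MulAction Sᵐᵒᵖ B] (z : B) : ActCon S S where
  toSetoid := Setoid.ker fun x : S => z <• x
  act' {x y} s (h : z <• x = z <• y) := by
    change z <• (x * s) = z <• (y * s)
    rw [← act_act, h, act_act]

theorem ker_iff {z : B} {x y : S} : (ker S z).toSetoid x y ↔ z <• x = z <• y := Iff.rfl

end ActCon

/-- The witnesses that flatness supplies in `B` might fall outside `z S`; confluence and maximality
of `z` force them back below `z`. -/
theorem Flat.ker {e : Prop} (hB : Flat S e B) {z : B} (hz : IsMaximalGenerator S z) :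
    Flat S e (ActCon.ker S z).Quot := by
  have key : ∀ (c : B) (p s : S), z <• p = c <• s → Below S c z := by
    intro c p s h
    obtain ⟨d, hd, hd'⟩ := hB.1.below_common (below_act z p) ⟨s, h⟩
    exact hd'.trans (hz d hd)
  refine ⟨?_, fun he => ?_⟩
  · intro q q' u v h
    obtain ⟨x, rfl⟩ := ActCon.cls_surjective _ q
    obtain ⟨y, rfl⟩ := ActCon.cls_surjective _ q'
    have h' : (z <• x) <• u = (z <• y) <• v := by
      rw [act_act, act_act]; exact ActCon.cls_eq.1 h
    obtain ⟨c, s, s', hs, hs', hsu⟩ := hB.1 _ _ u v h'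
    obtain ⟨r, rfl⟩ := key c x s hs
    rw [act_act] at hs hs'
    exact ⟨ActCon.cls _ r, s, s', ActCon.cls_eq.2 hs, ActCon.cls_eq.2 hs', hsu⟩
  · intro q u v h
    obtain ⟨x, rfl⟩ := ActCon.cls_surjective _ q
    have h' : (z <• x) <• u = (z <• x) <• v := by
      rw [act_act, act_act]; exact ActCon.cls_eq.1 h
    obtain ⟨c, s, hs, hsu⟩ := hB.2 he _ u v h'
    obtain ⟨r, rfl⟩ := key c x s hs
    rw [act_act] at hs
    exact ⟨ActCon.cls _ r, s, ActCon.cls_eq.2 hs, hsu⟩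

theorem iterate_act (φ : B →[Sᵐᵒᵖ] B) (d : ℕ) (x : B) (s : S) :
    (⇑φ)^[d] (x <• s) = (⇑φ)^[d] x <• s :=
  (Function.Commute.iterate_left (f := φ) (g := fun x : B => x <• s)
    (fun x => map_smul φ _ x) d) x

/-- The congruence whose quotient is the colimit of `B → B → ⋯` along an endomorphism. -/
def colimitCon (φ : B →[Sᵐᵒᵖ] B) : ActCon S B where
  r x y := ∃ d e : ℕ, (⇑φ)^[d] x = (⇑φ)^[e] y
  iseqv :=
    { refl := fun _ => ⟨0, 0, rfl⟩
      symm := fun ⟨d, e, h⟩ => ⟨e, d, h.symm⟩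
      trans := by
        rintro x y z ⟨d, e, h⟩ ⟨d', e', h'⟩
        refine ⟨d' + d, e + e', ?_⟩
        rw [Function.iterate_add_apply, h, ← Function.iterate_add_apply, add_comm,
          Function.iterate_add_apply, h', ← Function.iterate_add_apply] }
  act' := by
    rintro x y s ⟨d, e, h⟩
    exact ⟨d, e, by rw [iterate_act, iterate_act, h]⟩

theorem colimitCon_iterate (φ : B →[Sᵐᵒᵖ] B) (d : ℕ) (x : B) :
    (colimitCon φ).cls ((⇑φ)^[d] x) = (colimitCon φ).cls x :=
  ActCon.cls_eq.2 ⟨0, d, rfl⟩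

/-- Flatness passes to the colimit when a grading forces both iterates in the congruence to have
the same exponent on orbits. -/
theorem Flat.colimit {e : Prop} (hB : Flat S e B) (φ : B →[Sᵐᵒᵖ] B) (level : B → ℕ)
    (hact : ∀ x (s : S), level (x <• s) = level x) (hφ : ∀ x, level (φ x) = level x + 1) :
    Flat S e (colimitCon φ).Quot := by
  have hiter : ∀ d x, level ((⇑φ)^[d] x) = level x + d := by
    intro d
    induction d with
    | zero => intro x; rfl
    | succ d ih => intro x; rw [Function.iterate_succ_apply, ih, hφ]; ring
  refine ⟨?_, fun he => ?_⟩
  · intro q q' u v h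
    obtain ⟨x, rfl⟩ := ActCon.cls_surjective _ q
    obtain ⟨y, rfl⟩ := ActCon.cls_surjective _ q'
    obtain ⟨d, d', h⟩ := ActCon.cls_eq.1 h
    rw [iterate_act, iterate_act] at h
    obtain ⟨c, s, s', hs, hs', hsu⟩ := hB.1 _ _ u v h
    refine ⟨ActCon.cls _ c, s, s', ?_, ?_, hsu⟩
    · rw [← colimitCon_iterate φ d x, hs]; rfl
    · rw [← colimitCon_iterate φ d' y, hs']; rfl
  · intro q u v h
    obtain ⟨x, rfl⟩ := ActCon.cls_surjective _ q
    obtain ⟨d, d', h⟩ := ActCon.cls_eq.1 h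
    rw [iterate_act, iterate_act] at h
    -- Condition (E) concerns a single element, so the two iterates of `x` must coincide; the
    -- grading ensures this.
    have hd : d = d' := by
      have := congrArg level h
      rw [hact, hact, hiter, hiter] at this
      omega
    subst hd
    obtain ⟨c, s, hs, hsu⟩ := hB.2 he _ u v h
    refine ⟨ActCon.cls _ c, s, ?_, hsu⟩
    rw [← colimitCon_iterate φ d x, hs]; rfl

end Congruence
-- Cyclic flat acts over `A`: maximal and terminal objects.
section Objects

variable (S : Type u) [Monoid S] (e : Prop) (A : Type v) [MulAction Sᵐᵒᵖ A]

/-- A cyclic flat act over `A`: a congruence on `S` with flat quotient, and the image in `A` of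
the class of `1`. -/
structure CyclicOver where
  con : ActCon S S
  flat : Flat S e con.Quot
  pt : A
  compat : ∀ {x y : S}, con.toSetoid x y → pt <• x = pt <• y

variable {S e A}

namespace CyclicOver

/-- The structure map of a cyclic act over `A`. -/
def toMap (X : CyclicOver S e A) : X.con.Quot →[Sᵐᵒᵖ] A :=
  X.con.lift ⟨fun s => X.pt <• s, fun s x => (act_act X.pt x s.unop).symm⟩ fun _ _ => X.compat

/-- `t` represents the image of the class of `1` under a map `X → Y` over `A`. -/
structure IsHom (X Y : CyclicOver S e A) (t : S) : Prop where
  pt_eq : X.pt = Y.pt <• t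
  rel : ∀ {x y : S}, X.con.toSetoid x y → Y.con.toSetoid (t * x) (t * y)

/-- The map `X → Y` over `A` represented by `t` is bijective. -/
structure IsIso (X Y : CyclicOver S e A) (t : S) : Prop where
  inj : ∀ {x y : S}, Y.con.toSetoid (t * x) (t * y) → X.con.toSetoid x y
  surj : ∃ u, Y.con.toSetoid (t * u) 1

theorem IsHom.comp {X Y Z : CyclicOver S e A} {t t' : S} (h : IsHom X Y t) (h' : IsHom Y Z t') :
    IsHom X Z (t' * t) :=
  ⟨by rw [h.pt_eq, h'.pt_eq, act_act], fun hx => by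
    rw [mul_assoc, mul_assoc]; exact h'.rel (h.rel hx)⟩

theorem IsHom.one (X : CyclicOver S e A) : IsHom X X 1 :=
  ⟨(act_one _).symm, fun hx => by simpa using hx⟩

theorem IsHom.inverse {X Y : CyclicOver S e A} {t : S} (h : IsHom X Y t) (h' : IsIso X Y t) :
    ∃ u, IsHom Y X u := by
  obtain ⟨u, hu⟩ := h'.surj
  refine ⟨u, ?_, fun {x y} hxy => h'.inj ?_⟩
  · rw [h.pt_eq, act_act, Y.compat hu, act_one]
  · have key : ∀ z, Y.con.toSetoid (t * (u * z)) z := fun z => by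
      have := Y.con.act' z hu
      simpa [mul_assoc] using this
    exact Y.con.trans' (Y.con.trans' (key x) hxy) (Y.con.symm' (key y))

/-- The map induced by a morphism of cyclic acts over `A`. -/
def IsHom.map {X Y : CyclicOver S e A} {t : S} (h : IsHom X Y t) :
    X.con.Quot →[Sᵐᵒᵖ] Y.con.Quot :=
  X.con.lift ⟨fun s => Y.con.cls (t * s), fun s x =>
    congrArg Y.con.cls (mul_assoc t x s.unop).symm⟩ fun _ _ hx => ActCon.cls_eq.2 (h.rel hx)

/-- The congruence of `X` cannot be enlarged over the same point of `A`. -/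
def IsMaximal (X : CyclicOver S e A) : Prop :=
  ∀ Y : CyclicOver S e A, Y.pt = X.pt →
    X.con.toSetoid ≤ Y.con.toSetoid → Y.con.toSetoid ≤ X.con.toSetoid

/-- The act over `A` on a directed union of congruences. -/
theorem exists_union (c : Set (CyclicOver S e A)) (hne : c.Nonempty) (a : A)
    (hpt : ∀ X ∈ c, X.pt = a)
    (hc : ∀ X ∈ c, ∀ Y ∈ c, X.con.toSetoid ≤ Y.con.toSetoid ∨ Y.con.toSetoid ≤ X.con.toSetoid) :
    ∃ Z : CyclicOver S e A, Z.pt = a ∧ ∀ X ∈ c, X.con.toSetoid ≤ Z.con.toSetoid := by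
  obtain ⟨X₀, hX₀⟩ := hne
  let r : ActCon S S :=
    { r := fun x y => ∃ X ∈ c, X.con.toSetoid x y
      iseqv :=
        { refl := fun x => ⟨X₀, hX₀, X₀.con.refl' x⟩
          symm := fun ⟨X, hX, h⟩ => ⟨X, hX, X.con.symm' h⟩
          trans := by
            rintro x y z ⟨X, hX, h⟩ ⟨Y, hY, h'⟩
            rcases hc X hX Y hY with hXY | hXY
            · exact ⟨Y, hY, Y.con.trans' (hXY h) h'⟩
            · exact ⟨X, hX, X.con.trans' h (hXY h')⟩ }
      act' := fun s ⟨X, hX, h⟩ => ⟨X, hX, X.con.act' s h⟩ }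
  have hr : ∀ X ∈ c, X.con.toSetoid ≤ r.toSetoid := fun X hX x y h => ⟨X, hX, h⟩
  have hflat : Flat S e r.Quot := by
    have push : ∀ X ∈ c, ∀ {x y : S} {s : S}, X.con.cls x = X.con.cls y <• s →
        r.cls x = r.cls y <• s := fun X hX x y s h =>
      ActCon.cls_eq.2 (hr X hX (ActCon.cls_eq.1 h))
    refine ⟨?_, fun he => ?_⟩
    · intro q q' u v h
      obtain ⟨x, rfl⟩ := ActCon.cls_surjective _ q
      obtain ⟨y, rfl⟩ := ActCon.cls_surjective _ q'
      obtain ⟨X, hX, h⟩ := ActCon.cls_eq.1 h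
      obtain ⟨p, s, s', hs, hs', hsu⟩ :=
        X.flat.1 (X.con.cls x) (X.con.cls y) u v (ActCon.cls_eq.2 h)
      obtain ⟨p, rfl⟩ := ActCon.cls_surjective _ p
      exact ⟨r.cls p, s, s', push X hX hs, push X hX hs', hsu⟩
    · intro q u v h
      obtain ⟨x, rfl⟩ := ActCon.cls_surjective _ q
      obtain ⟨X, hX, h⟩ := ActCon.cls_eq.1 h
      obtain ⟨p, s, hs, hsu⟩ := X.flat.2 he (X.con.cls x) u v (ActCon.cls_eq.2 h)
      obtain ⟨p, rfl⟩ := ActCon.cls_surjective _ p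
      exact ⟨r.cls p, s, push X hX hs, hsu⟩
  refine ⟨⟨r, hflat, a, ?_⟩, rfl, hr⟩
  rintro x y ⟨X, hX, h⟩
  rw [← hpt X hX]
  exact X.compat h

theorem exists_isMaximal (X : CyclicOver S e A) :
    ∃ Y : CyclicOver S e A, Y.IsMaximal ∧ IsHom X Y 1 := by
  -- Zorn is applied to the underlying setoids; unions of chains remain flat because each flatness
  -- witness uses only one member.
  obtain ⟨m, hXm, ⟨Y, ⟨hYpt, rfl⟩⟩, hmax⟩ := zorn_le_nonempty₀
    {r : Setoid S | ∃ Y : CyclicOver S e A, Y.pt = X.pt ∧ Y.con.toSetoid = r} (by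
      intro c hcs hc r hr
      obtain ⟨Z, hZ, hub⟩ := exists_union
        {Y : CyclicOver S e A | Y.pt = X.pt ∧ Y.con.toSetoid ∈ c}
        (by obtain ⟨Y, hY, rfl⟩ := hcs hr; exact ⟨Y, hY, hr⟩) X.pt (fun Y hY => hY.1)
        fun Y hY Z hZ => hc.total hY.2 hZ.2
      refine ⟨_, ⟨Z, hZ, rfl⟩, fun r hr => ?_⟩
      obtain ⟨Y, hY, rfl⟩ := hcs hr
      exact hub Y ⟨hY, hr⟩) X.con.toSetoid ⟨X, rfl, rfl⟩
  refine ⟨Y, fun Z hZ hYZ => hmax ⟨Z, hZ.trans hYpt, rfl⟩ hYZ, ?_, fun {x y} h => ?_⟩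
  · rw [act_one, hYpt]
  · simpa using hXm h

/-- Under condition (A), a sequence of maps between maximal cyclic acts over `A` contains an
isomorphism. -/
theorem exists_isIso (h : ConditionA.{u, u} S) (X : ℕ → CyclicOver S e A)
    (hX : ∀ n, (X n).IsMaximal) (t : ℕ → S) (ht : ∀ n, IsHom (X n) (X (n + 1)) (t n)) :
    ∃ n, IsIso (X n) (X (n + 1)) (t n) := by
  -- The colimit of the sequence is presented as the coproduct modulo the shift, graded by the
  -- index.
  let φ : (Σ n, (X n).con.Quot) →[Sᵐᵒᵖ] (Σ n, (X n).con.Quot) :=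
    ⟨fun p => ⟨p.1 + 1, (ht p.1).map p.2⟩, fun s p => by
      obtain ⟨n, q⟩ := p
      exact congrArg (Sigma.mk (n + 1)) (map_smul (ht n).map s q)⟩
  let C := colimitCon φ
  have hflat : Flat S e C.Quot :=
    (Flat.sigma fun n => (X n).flat).colimit φ Sigma.fst (fun _ _ => rfl) fun _ => rfl
  let a : ℕ → C.Quot := fun n => C.cls ⟨n, (X n).con.cls 1⟩
  have ha : ∀ n s, a n <• s = C.cls ⟨n, (X n).con.cls s⟩ := fun n s =>
    congrArg (fun x => C.cls ⟨n, (X n).con.cls x⟩) (one_mul s)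
  have hstep : ∀ n, a n = a (n + 1) <• t n := fun n => by
    rw [ha, ← mul_one (t n)]
    exact (colimitCon_iterate φ 1 _).symm
  have hbelow : ∀ n, Below S (a n) (a (n + 1)) := fun n => ⟨t n, hstep n⟩
  obtain ⟨N, hN⟩ := h C.Quot a fun n => cyclicSubact_subset_iff.2 (hbelow n)
  have hgen : ∀ n, N ≤ n → ∀ q, Below S q (a n) := by
    intro n hn q
    obtain ⟨⟨m, x⟩, rfl⟩ := ActCon.cls_surjective _ q
    obtain ⟨s, rfl⟩ := ActCon.cls_surjective _ x
    have h₁ : Below S (a m) (a (max N m)) := below_of_le hbelow (le_max_right _ _)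
    have h₂ : Below S (a (max N m)) (a N) :=
      cyclicSubact_subset_iff.1 (hN _ (le_max_left _ _)).subset
    exact Below.trans ⟨s, (ha m s).symm⟩ (h₁.trans (h₂.trans (below_of_le hbelow hn)))
  -- Since `a n` generates the colimit, its kernel is a flat congruence containing that of `X n`
  -- over the same point, so maximality gives equality.
  have hker : ∀ n, N ≤ n → ∀ {x y : S}, a n <• x = a n <• y → (X n).con.toSetoid x y := by
    intro n hn x y hxy
    let ψ : (Σ n, (X n).con.Quot) → A := fun p => (X p.1).toMap p.2
    have hψ : ∀ p, ψ (φ p) = ψ p := by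
      rintro ⟨n, q⟩
      obtain ⟨s, rfl⟩ := ActCon.cls_surjective _ q
      change (X (n + 1)).pt <• (t n * s) = (X n).pt <• s
      rw [(ht n).pt_eq, act_act]
    have hψ' : ∀ d p, ψ ((⇑φ)^[d] p) = ψ p := by
      intro d
      induction d with
      | zero => intro p; rfl
      | succ d ih => intro p; rw [Function.iterate_succ_apply, ih, hψ]
    let Y : CyclicOver S e A :=
      { con := ActCon.ker S (a n)
        flat := hflat.ker fun c _ => hgen n hn c
        pt := (X n).pt
        compat := by
          intro x y hxy
          rw [ActCon.ker_iff, ha, ha] at hxy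
          obtain ⟨d, d', hd⟩ := ActCon.cls_eq.1 hxy
          have := congrArg ψ hd
          rwa [hψ', hψ'] at this }
    refine hX n Y rfl (fun x y hxy => ?_) hxy
    change a n <• x = a n <• y
    rw [ha, ha, ActCon.cls_eq.2 hxy]
  refine ⟨N, fun {x y} hxy => hker N le_rfl ?_, ?_⟩
  · rw [hstep, act_act, act_act, ha, ha, ActCon.cls_eq.2 hxy]
  · obtain ⟨v, hv⟩ := hgen N le_rfl (a (N + 1))
    refine ⟨v, hker (N + 1) N.le_succ ?_⟩
    rw [← act_act, ← hstep, act_one, ← hv]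

/-- `X` is maximal and every map over `A` from it to a maximal act is an isomorphism. -/
def IsTerminal (X : CyclicOver S e A) : Prop :=
  X.IsMaximal ∧ ∀ Y : CyclicOver S e A, Y.IsMaximal → ∀ t, IsHom X Y t → IsIso X Y t

/-- By `exists_isIso`, non-isomorphisms between maximal objects form no infinite sequence, so one
reachable from `X` admits none out of it. -/
theorem exists_isTerminal (h : ConditionA.{u, u} S) (X : CyclicOver S e A) :
    ∃ Y : CyclicOver S e A, Y.IsTerminal ∧ ∃ t, IsHom X Y t := by
  obtain ⟨X', hX', hXX'⟩ := X.exists_isMaximal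
  have wf : WellFounded fun Z Y : {Y : CyclicOver S e A // Y.IsMaximal} =>
      ∃ t, IsHom Y.1 Z.1 t ∧ ¬ IsIso Y.1 Z.1 t := by
    rw [wellFounded_iff_isEmpty_descending_chain]
    refine ⟨fun ⟨Y, hY⟩ => ?_⟩
    choose t ht hn using hY
    obtain ⟨n, hn'⟩ := exists_isIso h (fun n => (Y n).1) (fun n => (Y n).2) t ht
    exact hn n hn'
  obtain ⟨⟨Y, hYm⟩, ⟨t, hXY⟩, hY⟩ := wf.has_min {Y | ∃ t, IsHom X Y.1 t} ⟨⟨X', hX'⟩, 1, hXX'⟩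
  refine ⟨Y, ⟨hYm, fun Z hZ s hs => ?_⟩, t, hXY⟩
  by_contra hn
  exact hY ⟨Z, hZ⟩ ⟨_, hXY.comp hs⟩ ⟨s, hs, hn⟩

variable (S e A) in
/-- Terminal cyclic acts over `A`, up to isomorphism. -/
def terminalSetoid : Setoid {X : CyclicOver S e A // X.IsTerminal} where
  r X Y := ∃ t, IsHom X.1 Y.1 t
  iseqv :=
    { refl := fun X => ⟨1, IsHom.one X.1⟩
      symm := fun {X Y} ⟨t, ht⟩ => ht.inverse (X.2.2 Y.1 Y.2.1 t ht)
      trans := fun ⟨_, ht⟩ ⟨_, ht'⟩ => ⟨_, ht.comp ht'⟩ }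

variable (S e A) in
/-- The index type of the components of the cover. -/
def Index : Type (max u v) := Quotient (terminalSetoid S e A)

/-- The representative of an isomorphism class. -/
noncomputable def Index.obj (i : Index S e A) : CyclicOver S e A := (Quotient.out i).1

theorem Index.isTerminal (i : Index S e A) : i.obj.IsTerminal := (Quotient.out i).2

theorem Index.exists_isHom (h : ConditionA.{u, u} S) (X : CyclicOver S e A) :
    ∃ (i : Index S e A) (t : S), IsHom X i.obj t := by
  obtain ⟨Y, hY, t, ht⟩ := X.exists_isTerminal h
  obtain ⟨s, hs⟩ := (terminalSetoid S e A).symm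
    (Quotient.mk_out (s := terminalSetoid S e A) ⟨Y, hY⟩)
  exact ⟨Quotient.mk _ ⟨Y, hY⟩, _, ht.comp hs⟩

theorem Index.eq_of_isHom {i j : Index S e A} {t : S} (h : IsHom i.obj j.obj t) : i = j :=
  Quotient.out_equiv_out.1 ⟨t, h⟩

end CyclicOver

end Objects

/-! ### The coproduct of terminal objects is a cover. -/

section Cover

variable {S : Type u} [Monoid S] {e : Prop} {A : Type (max u v)} [MulAction Sᵐᵒᵖ A]

open CyclicOver

variable (S e A) in
/-- The coproduct of the terminal cyclic flat acts over `A`. -/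
abbrev CoverAct : Type (max u v) := Σ i : Index S e A, i.obj.con.Quot

variable (S e A) in
/-- The structure map of the coproduct. -/
noncomputable def coverMap : CoverAct S e A →[Sᵐᵒᵖ] A where
  toFun p := p.1.obj.toMap p.2
  map_smul' s p := map_smul p.1.obj.toMap s p.2

theorem cls_one_act (i : Index S e A) (s : S) :
    (⟨i, i.obj.con.cls 1⟩ : CoverAct S e A) <• s = ⟨i, i.obj.con.cls s⟩ :=
  congrArg (fun x => (⟨i, i.obj.con.cls x⟩ : CoverAct S e A)) (one_mul s)

theorem cls_act_eq (i : Index S e A) (t s : S) :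
    (⟨i, i.obj.con.cls t⟩ : CoverAct S e A) <• s = ⟨i, i.obj.con.cls (t * s)⟩ := rfl

theorem CoverAct.cls_inj {i : Index S e A} {x y : S} :
    (⟨i, i.obj.con.cls x⟩ : CoverAct S e A) = ⟨i, i.obj.con.cls y⟩ ↔
      i.obj.con.toSetoid x y := by
  rw [Sigma.mk.injEq, heq_eq_eq, ActCon.cls_eq]
  simp

theorem coverMap_cls (i : Index S e A) (s : S) :
    coverMap S e A ⟨i, i.obj.con.cls s⟩ = i.obj.pt <• s := rfl

variable (e) in
/-- A maximal generator of a flat act over `A` is sent to some element of the coproduct. -/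
theorem exists_coverAct_of_maximalGenerator (h : ConditionA.{u, u} S) {P : Type*}
    [MulAction Sᵐᵒᵖ P] (hP : Flat S e P) (g : P →[Sᵐᵒᵖ] A) {z : P}
    (hz : IsMaximalGenerator S z) :
    ∃ y : CoverAct S e A, coverMap S e A y = g z ∧
      ∀ s t : S, z <• s = z <• t → y <• s = y <• t := by
  obtain ⟨i, t, ht⟩ := Index.exists_isHom h
    { con := ActCon.ker S z
      flat := hP.ker hz
      pt := g z
      compat := fun {x y} (hxy : z <• x = z <• y) => by
        rw [← map_smul, hxy, map_smul] : CyclicOver S e A }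
  refine ⟨⟨i, i.obj.con.cls t⟩, ht.pt_eq.symm, fun x y hxy => ?_⟩
  rw [cls_act_eq, cls_act_eq, CoverAct.cls_inj]
  exact ht.rel hxy

variable (e) in
theorem isPrecover_coverMap (hu : ConditionA.{u, u} S) (h : ConditionA.{u, max u v} S) :
    IsPrecover (fun P _ => Flat S e P) (coverMap S e A) := by
  refine ⟨Flat.sigma fun i => i.obj.flat, fun P _ hP g => ?_⟩
  let conn : Setoid P :=
    { r := fun x y => ∃ z, Below S x z ∧ Below S y z
      iseqv :=
        { refl := fun x => ⟨x, Below.refl x, Below.refl x⟩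
          symm := fun ⟨z, hx, hy⟩ => ⟨z, hy, hx⟩
          trans := by
            rintro x y w ⟨z, hx, hy⟩ ⟨z', hy', hw⟩
            obtain ⟨d, hd, hd'⟩ := hP.1.below_common hy hy'
            exact ⟨d, hx.trans hd, hw.trans hd'⟩ } }
  choose z hz hmax using fun q : Quotient conn => h.exists_maximalGenerator q.out
  have hbelow : ∀ p : P, Below S p (z (Quotient.mk conn p)) := by
    intro p
    obtain ⟨d, hd, hp⟩ := Quotient.mk_out (s := conn) p
    obtain ⟨d', hd', hz'⟩ := hP.1.below_common hd (hz (Quotient.mk conn p))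
    exact hp.trans (hd'.trans (hmax _ d' hz'))
  choose y hy hker using fun q => exists_coverAct_of_maximalGenerator e hu hP g (hmax q)
  choose s hs using hbelow
  have hq : ∀ (p : P) (t : S), Quotient.mk conn (p <• t) = Quotient.mk conn p := fun p t =>
    Quotient.sound ⟨p, below_act p t, Below.refl p⟩
  refine ⟨⟨fun p => y (Quotient.mk conn p) <• s p, fun t p => ?_⟩, ?_⟩
  · change y (Quotient.mk conn (p <• t.unop)) <• s (p <• t.unop) =
      (y (Quotient.mk conn p) <• s p) <• t.unop
    rw [hq, act_act]
    -- The coefficients `s p` are arbitrary choices, but `hker` lets the comparison be made in `P`,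
    -- where they agree.
    refine hker _ _ _ ?_
    rw [← act_act, ← hs p, ← hq p t.unop, ← hs]
  · ext p
    change coverMap S e A (y (Quotient.mk conn p) <• s p) = g p
    rw [map_smul, hy, ← map_smul, ← hs]

/-- A map over `A` between chosen terminal representatives makes them isomorphic, hence the same
component, and terminality makes it bijective. -/
theorem coverMap_endo (f : CoverAct S e A →[Sᵐᵒᵖ] CoverAct S e A)
    (hf : (coverMap S e A).comp f = coverMap S e A) (i : Index S e A) :
    ∃ t : S, IsIso i.obj i.obj t ∧
      ∀ s, f ⟨i, i.obj.con.cls s⟩ = ⟨i, i.obj.con.cls (t * s)⟩ := by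
  obtain ⟨⟨j, q⟩, hq⟩ : ∃ p, f ⟨i, i.obj.con.cls 1⟩ = p := ⟨_, rfl⟩
  obtain ⟨t, rfl⟩ := ActCon.cls_surjective _ q
  have hs : ∀ s, f ⟨i, i.obj.con.cls s⟩ = ⟨j, j.obj.con.cls (t * s)⟩ := fun s => by
    rw [← cls_one_act, map_smul, hq, cls_act_eq]
  have ht : IsHom i.obj j.obj t := by
    refine ⟨?_, fun {x y} hxy => ?_⟩
    · have := DFunLike.congr_fun hf ⟨i, i.obj.con.cls 1⟩
      rw [MulActionHom.comp_apply, hq, coverMap_cls, coverMap_cls, act_one] at this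
      exact this.symm
    · rw [← CoverAct.cls_inj, ← hs, ← hs, CoverAct.cls_inj.2 hxy]
  obtain rfl := Index.eq_of_isHom ht
  exact ⟨t, i.isTerminal.2 _ i.isTerminal.1 t ht, hs⟩

variable (S e A) in
theorem hasCover_flat (h : ConditionA.{u, max u v} S) :
    HasCover (S := S) (fun P _ => Flat S e P) A := by
  refine ⟨CoverAct S e A, inferInstance, coverMap S e A,
    isPrecover_coverMap e (ConditionA.down.{u, v} S h) h, fun f hf => ?_⟩
  choose t ht hs using coverMap_endo f hf
  constructor
  · rintro ⟨i, p⟩ ⟨j, q⟩ hpq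
    obtain ⟨x, rfl⟩ := ActCon.cls_surjective _ p
    obtain ⟨y, rfl⟩ := ActCon.cls_surjective _ q
    rw [hs, hs] at hpq
    obtain rfl : i = j := congrArg Sigma.fst hpq
    exact CoverAct.cls_inj.2 ((ht i).inj (CoverAct.cls_inj.1 hpq))
  · rintro ⟨i, q⟩
    obtain ⟨y, rfl⟩ := ActCon.cls_surjective _ q
    obtain ⟨u, hu⟩ := (ht i).surj
    refine ⟨⟨i, i.obj.con.cls (u * y)⟩, ?_⟩
    rw [hs, CoverAct.cls_inj, ← mul_assoc]
    simpa using i.obj.con.act' y hu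

end Cover

theorem ConditionA.everyActHasSFAndCPCover {S : Type u} [Monoid S]
    (h : ConditionA.{u, max u v} S) : EveryActHasSFAndCPCover.{u, max u v} S := by
  intro A _
  have hSF := hasCover_flat S True A h
  have hCP := hasCover_flat S False A h
  simp only [Flat, true_imp_iff, false_imp_iff, and_true] at hSF hCP
  exact ⟨hSF, hCP⟩

/-! ### Monoids satisfying condition (A). -/

section Examples

theorem conditionA_of_finite (S : Type u) [Monoid S] [Finite S] : ConditionA.{u, v} S := by
  rw [conditionA_iff_wellFounded]
  intro A _
  have hfin : ∀ a : A, (cyclicSubact S a).Finite := fun a =>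
    (Set.finite_range fun s : S => a <• s).subset fun x ⟨s, hs⟩ => ⟨s, hs.symm⟩
  have hcard : ∀ a : A, (cyclicSubact S a).ncard ≤ Nat.card S := by
    intro a
    have : cyclicSubact S a = Set.range fun s : S => a <• s :=
      Set.ext fun x => ⟨fun ⟨s, hs⟩ => ⟨s, hs.symm⟩, fun ⟨s, hs⟩ => ⟨s, hs.symm⟩⟩
    rw [this]
    exact Finite.card_range_le _
  refine Subrelation.wf (r := InvImage (· < ·) fun a : A =>
    Nat.card S - (cyclicSubact S a).ncard) ?_ (InvImage.wf _ Nat.lt_wfRel.wf)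
  rintro c z ⟨hzc, hcz⟩
  have hlt : (cyclicSubact S z).ncard < (cyclicSubact S c).ncard :=
    Set.ncard_lt_ncard ⟨cyclicSubact_subset_iff.2 hzc,
      fun h => hcz (cyclicSubact_subset_iff.1 h)⟩ (hfin c)
  have := hcard c
  change Nat.card S - _ < Nat.card S - _
  omega

/-- In a strict chain no multiplier is `1`; with `a 0 = a 2 q p` and `a 1 = a 2 q`, solving `q p x =
q` gives `a 0 x = a 1`. -/
theorem conditionA_withOne (R : Type u) [Semigroup R] (h : ∀ s t : R, ∃ x, s * t * x = s) :
    ConditionA.{u, v} (WithOne R) := by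
  refine conditionA_of_no_strict_chain _ fun A _ a s has => ?_
  by_contra! hn
  have hs : ∀ n, ∃ r : R, s n = r := by
    intro n
    cases hsn : s n with
    | one => exact absurd ⟨1, by rw [has n, hsn, act_one, act_one]⟩ (hn n)
    | coe r => exact ⟨r, rfl⟩
  obtain ⟨p, hp⟩ := hs 0
  obtain ⟨q, hq⟩ := hs 1
  obtain ⟨x, hx⟩ := h q p
  refine hn 0 ⟨x, ?_⟩
  rw [has 0, has 1, hp, hq, act_act, act_act, ← mul_assoc, ← WithOne.coe_mul,
    ← WithOne.coe_mul, hx]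

/-- Idempotency makes `s n` fix `a n`. If `s n ≤ s (n + 1)`, then `s n` also fixes `a (n + 1)`, so
the two elements are equal; a strict chain would thus make `s` strictly decreasing. -/
theorem conditionA_maxNat : ConditionA.{0, v} MaxNat := by
  refine conditionA_of_no_strict_chain _ fun A _ a s has => ?_
  by_contra! hn
  have hidem : ∀ n, a n <• s n = a n := fun n => by
    rw [has n, act_act]
    exact congrArg (a (n + 1) <• ·) (Nat.max_self (s n))
  have hlt : ∀ n, @LT.lt ℕ _ (s (n + 1)) (s n) := by
    intro n
    by_contra hle
    refine hn n ⟨1, ?_⟩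
    have hmul : s (n + 1) * s n = s (n + 1) := Nat.max_eq_left (not_lt.1 hle)
    rw [act_one, has n]
    calc a (n + 1) = a (n + 1) <• (s (n + 1) * s n) := by rw [hmul, hidem]
      _ = a (n + 1) <• s n := by rw [← act_act, hidem]
  exact (wellFounded_iff_isEmpty_descending_chain.1 Nat.lt_wfRel.wf).false ⟨s, hlt⟩

end Examples

end RightAct

theorem mainTheorem5 :
    -- the two forms of condition (A) agree
    (∀ (S : Type u) [Monoid S],
      RightAct.ConditionA.{u, max u v} S ↔
        ∀ (A : Type (max u v)) [MulAction Sᵐᵒᵖ A],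
          RightAct.IsLocallyCyclic S A → RightAct.IsCyclic S A) ∧
    -- condition (A) gives SF-covers and CP-covers
    (∀ (S : Type u) [Monoid S], RightAct.ConditionA.{u, max u v} S →
      RightAct.EveryActHasSFAndCPCover.{u, max u v} S) ∧
    -- under condition (A) the indecomposable acts with (P) are cyclic and of size at most `|S|`
    (∀ (S : Type u) [Monoid S], RightAct.ConditionA.{u, max u v} S →
      ∀ (A : Type (max u v)) [MulAction Sᵐᵒᵖ A],
        RightAct.ConditionP S A → RightAct.IsIndecomposable S A →
          RightAct.IsCyclic S A ∧ Cardinal.mk A ≤ Cardinal.lift.{v} (Cardinal.mk S)) ∧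
    -- finite monoids
    (∀ (S : Type u) [Monoid S], Finite S →
      RightAct.ConditionA.{u, max u v} S ∧
        RightAct.EveryActHasSFAndCPCover.{u, max u v} S) ∧
    -- rectangular bands with a 1 adjoined
    (∀ (R : Type u) [Semigroup R], RightAct.IsRectangularBand R →
      RightAct.ConditionA.{u, max u v} (WithOne R) ∧
        RightAct.EveryActHasSFAndCPCover.{u, max u v} (WithOne R)) ∧
    -- right groups with a 1 adjoined
    (∀ (R : Type u) [Semigroup R], RightAct.IsRightGroup R →
      RightAct.ConditionA.{u, max u v} (WithOne R) ∧
        RightAct.EveryActHasSFAndCPCover.{u, max u v} (WithOne R)) ∧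
    -- right simple semigroups with a 1 adjoined
    (∀ (R : Type u) [Semigroup R], RightAct.IsRightSimple R →
      RightAct.ConditionA.{u, max u v} (WithOne R) ∧
        RightAct.EveryActHasSFAndCPCover.{u, max u v} (WithOne R)) ∧
    -- the monoid of natural numbers under max
    (RightAct.ConditionA.{0, v} RightAct.MaxNat ∧
      RightAct.EveryActHasSFAndCPCover.{0, v} RightAct.MaxNat) := by
  have hcov : ∀ (S : Type u) [Monoid S], RightAct.ConditionA.{u, max u v} S →
      RightAct.ConditionA.{u, max u v} S ∧ RightAct.EveryActHasSFAndCPCover.{u, max u v} S :=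
    fun S _ h => ⟨h, RightAct.ConditionA.everyActHasSFAndCPCover.{u, v} h⟩
  have hsimple : ∀ (R : Type u) [Semigroup R], RightAct.IsRightSimple R →
      RightAct.ConditionA.{u, max u v} (WithOne R) := fun R _ hR =>
    RightAct.conditionA_withOne R fun s t => hR (s * t) s
  refine ⟨fun S _ => ⟨fun h A _ hA => hA.isCyclic h, RightAct.conditionA_of_isLocallyCyclic S⟩,
    fun S _ h => (hcov S h).2, fun S _ h A _ hP hA => ?_,
    fun S _ _ => hcov S (RightAct.conditionA_of_finite S),
    fun R _ hR => hcov _ (RightAct.conditionA_withOne R fun s t => ⟨s, hR s t⟩),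
    fun R _ hR => hcov _ (hsimple R hR.1), fun R _ hR => hcov _ (hsimple R hR),
    RightAct.conditionA_maxNat,
    RightAct.ConditionA.everyActHasSFAndCPCover.{0, v} RightAct.conditionA_maxNat⟩
  have hc := (hP.isLocallyCyclic hA).isCyclic h
  exact ⟨hc, hc.mk_le⟩
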